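/- For $p\in\mathbb{C}$ with $|p|<1$ and $x\in\mathbb{C}\setminus\{0\}$ let $\theta(x;p)=\prod_{j\ge 0}(1-p^jx)(1-p^{j+1}/x)$ and $\theta(x_1,\dots,x_\ell;p)=\prod_{r}\theta(x_r;p)$. For nonzero $a,b,q\in\mathbb{C}$ and $z\in\mathbb{C}$ (with $q^z$ the principal power) define the elliptic number and the elliptic weight $$[z]_{a,b;q,p}=\frac{\theta(q^z,aq^z,bq,aq/b;p)}{\theta(q,aq,bq^z,aq^z/b;p)},\qquad W_{a,b;q,p}(z)=\frac{\theta(aq^{2z+1},b,bq,a/b,aq/b;p)}{\theta(aq,bq^z,bq^{z+1},aq^z/b,aq^{z+1}/b;p)}\,q^z ;$$ an elliptic number is called defined if no theta factor in its denominator vanishes. Put $x\!\downarrow_0^{a,b;q,p}=1$ and $x\!\downarrow_m^{a,b;q,p}=x(x-[1]_{a,b;q,p})\cdots(x-[m-1]_{a,b;q,p})$ for $m\ge 1$. Assume that $[i]_{a,b;q,p}$ is defined for every integer $i\ge 0$. Elliptic Stirling numbers of the second kind are numbers $S_{a,b;q,p}(n,k)$, $n,k\ge 0$, with $S_{a,b;q,p}(n,k)=0$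 for $k>n$ and $$[z]_{a,b;q,p}^n=\sum_{k=0}^n S_{a,b;q,p}(n,k)\;[z]_{a,b;q,p}\!\downarrow_k^{a,b;q,p}$$ for all $n\ge 0$ and all $z\in\mathbb{C}$ for which $[z]_{a,b;q,p}$ is defined. Such numbers exist. Moreover, let $n,k\ge 0$ be integers such that for all distinct $i,l\in\{0,\dots,k\}$ the elliptic number $[l-i]_{aq^{2i},bq^i;q,p}$ is defined and $W_{a,b;q,p}(i)\,[l-i]_{aq^{2i},bq^i;q,p}\ne 0$ (this holds for generic parameters). Then, for any such numbers, $$S_{a,b;q,p}(n,k)=\sum_{j=0}^{k}\Bigg(\prod_{\substack{0\le i\le k\\ i\ne k-j}}\big(W_{a,b;q,p}(i)\,[k-j-i]_{aq^{2i},bq^i;q,p}\big)^{-1}\Bigg)[k-j]_{a,b;q,p}^{\,n},$$ where $0^0=1$; in particular $S_{a,b;q,p}(n,k)$ is then uniquely determined. -/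

import Mathlib

noncomputable section

/-- The modified Jacobi theta function `θ(x; p) = ∏_{j ≥ 0} (1 - p^j x) (1 - p^(j+1) / x)`
(meant for `x ≠ 0` and `‖p‖ < 1`). -/
def modTheta (x p : ℂ) : ℂ :=
  ∏' j : ℕ, ((1 - p ^ j * x) * (1 - p ^ (j + 1) / x))

/-- The elliptic number `[z]_{a,b;q,p}` of a complex number `z`;
`q ^ z` is the principal power. -/
def ellipticNumber (a b q p z : ℂ) : ℂ :=
  (modTheta (q ^ z) p * modTheta (a * q ^ z) p * modTheta (b * q) p * modTheta (a * q / b) p) /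
    (modTheta q p * modTheta (a * q) p * modTheta (b * q ^ z) p * modTheta (a * q ^ z / b) p)

/-- No factor in the denominator of `[z]_{a,b;q,p}` vanishes. -/
def EllipticNumberDefined (a b q p z : ℂ) : Prop :=
  modTheta q p ≠ 0 ∧ modTheta (a * q) p ≠ 0 ∧
    modTheta (b * q ^ z) p ≠ 0 ∧ modTheta (a * q ^ z / b) p ≠ 0

/-- The elliptic weight `W_{a,b;q,p}(y)`. -/
def ellipticWeight (a b q p y : ℂ) : ℂ :=
  (modTheta (a * q ^ (2 * y + 1)) p * modTheta b p * modTheta (b * q) p *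
      modTheta (a / b) p * modTheta (a * q / b) p) /
    (modTheta (a * q) p * modTheta (b * q ^ y) p * modTheta (b * q ^ (y + 1)) p *
      modTheta (a * q ^ y / b) p * modTheta (a * q ^ (y + 1) / b) p) * q ^ y

/-- The elliptic falling factorial `x ↓_n = x (x - [1]) ⋯ (x - [n-1])`, with `x ↓_0 = 1`. -/
def ellipticFalling (a b q p x : ℂ) : ℕ → ℂ
  | 0 => 1
  | n + 1 => x * ∏ i ∈ Finset.Icc 1 n, (x - ellipticNumber a b q p (i : ℂ))

/-- `S` is an array of elliptic Stirling numbers of the second kind: `S n k = 0` for `k > n`, and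
`[z]^n = ∑_{k=0}^n S n k * ([z] ↓_k)` for all `n` and all `z` at which `[z]` is defined. -/
def IsEllipticStirling (a b q p : ℂ) (S : ℕ → ℕ → ℂ) : Prop :=
  (∀ n k : ℕ, n < k → S n k = 0) ∧
    ∀ (n : ℕ) (z : ℂ), EllipticNumberDefined a b q p z →
      ellipticNumber a b q p z ^ n =
        ∑ k ∈ Finset.range (n + 1),
          S n k * ellipticFalling a b q p (ellipticNumber a b q p z) k

end

/-!
The numbers `[i]`, `i = 0, 1, 2, …`, begin with `[0] = 0`, so the elliptic falling factorials are
the Newton basis polynomials `∏_{i < m} (x - [i])`. Expanding `x ^ n` in this basis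
(`pow_eq_sum_newtonCoeff`) gives an array of Stirling numbers. Conversely, an array of Stirling
numbers expresses `[l] ^ n` through the Newton basis at every node `[l]`, and when
`[0], …, [k]` are distinct, the divided difference at these nodes picks out the coefficient of
index `k` (`sum_newton_div`), so `S n k = ∑_l [l] ^ n / ∏_{i ≠ l} ([l] - [i])`.

The denominators take the product form of the claim because
`[l] - [i] = W(i) [l - i]_{a q^(2i), b q^i}` (`ellipticNumber_sub`), which after cancellation is
Weierstrass' addition formula (`modTheta_addition`). To prove the latter, the theta function is
expanded in its Laurent series by Jacobi's triple product identity (`exists_modTheta_eq_tsum`),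
obtained by dominated convergence from the finite triple product (`hasSum_tripleCoeff`).
Sorting the double series for `θ(x y) θ(x / y)` by the parity of the exponents shows that this
product is, up to a factor `C x`, the determinant of a `2 × 2` matrix whose rows depend on `x`
alone and on `y` alone (`tsum_thetaTerm_mul`). The addition formula is then the Plücker relation
for the `2 × 2` minors of a `4 × 2` matrix. The nome `p = 0`, where `θ(x; 0) = 1 - x`, is
treated directly.
-/

open Filter Topology

/-! ### Gaussian Laurent series -/

lemma summable_pow_sq_mul_pow {t y : ℂ} (ht : ‖t‖ < 1) :
    Summable fun n : ℕ => ‖t ^ (n ^ 2) * y ^ n‖ := by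
  by_cases ht0 : t = 0
  · refine summable_of_ne_finset_zero (s := {0}) fun n hn => ?_
    have : n ^ 2 ≠ 0 := pow_ne_zero _ (by simpa using hn)
    simp [ht0, zero_pow this]
  by_cases hy0 : y = 0
  · refine summable_of_ne_finset_zero (s := {0}) fun n hn => ?_
    have : n ≠ 0 := by simpa using hn
    simp [hy0, zero_pow this]
  refine summable_of_ratio_test_tendsto_lt_one (l := 0) one_pos ?_ ?_
  · exact .of_forall fun n => by simp [ht0, hy0]
  · have h1 : Tendsto (fun n : ℕ => (‖t‖ ^ 2) ^ n * (‖t‖ * ‖y‖)) atTop (𝓝 (0 * (‖t‖ * ‖y‖))) :=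
      (tendsto_pow_atTop_nhds_zero_of_lt_one (by positivity)
        (pow_lt_one₀ (norm_nonneg _) ht two_ne_zero)).mul_const _
    rw [zero_mul] at h1
    refine h1.congr fun n => ?_
    have h2 : ‖t‖ ≠ 0 := norm_ne_zero_iff.mpr ht0
    have h3 : ‖y‖ ≠ 0 := norm_ne_zero_iff.mpr hy0
    simp only [norm_norm, norm_mul, norm_pow]
    rw [eq_div_iff (by positivity)]
    ring

lemma summable_zpow_sq_mul_zpow {t y : ℂ} (ht : ‖t‖ < 1) :
    Summable fun k : ℤ => ‖t ^ (k ^ 2) * y ^ k‖ := by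
  refine .of_nat_of_neg ((summable_pow_sq_mul_pow (y := y) ht).congr fun n => ?_)
    ((summable_pow_sq_mul_pow (y := y⁻¹) ht).congr fun n => ?_)
  · congr 2
  · rw [neg_sq, zpow_neg, zpow_natCast, inv_pow]
    congr 2

/-! ### The finite triple product -/

/-- The finite Pochhammer product `(p; p)_n = ∏_{j=1}^n (1 - p^j)`. -/
def eulerPoch (p : ℂ) (n : ℕ) : ℂ := ∏ j ∈ Finset.range n, (1 - p ^ (j + 1))

/-- The reciprocal `1 / (p; p)_m`, extended to all integers `m` by `0` for `m < 0`. -/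
noncomputable def invEulerPoch (p : ℂ) (m : ℤ) : ℂ := if 0 ≤ m then (eulerPoch p m.toNat)⁻¹ else 0

lemma one_sub_pow_ne_zero {p : ℂ} (hp : ‖p‖ < 1) (j : ℕ) : 1 - p ^ (j + 1) ≠ 0 := by
  intro h
  have h1 : ‖p ^ (j + 1)‖ = 1 := by rw [← sub_eq_zero.mp h, norm_one]
  rw [norm_pow] at h1
  exact (pow_lt_one₀ (norm_nonneg _) hp j.succ_ne_zero).ne h1

/-- Thanks to the value `0` at negative integers, the recursion holds without restriction. -/
lemma invEulerPoch_sub_one {p : ℂ} (hp : ‖p‖ < 1) (m : ℤ) :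
    invEulerPoch p (m - 1) = (1 - p ^ m) * invEulerPoch p m := by
  rcases lt_trichotomy m 0 with h | rfl | h
  · simp only [invEulerPoch, not_le.mpr h, not_le.mpr (show m - 1 < 0 by lia), if_false, mul_zero]
  · simp [invEulerPoch]
  · obtain ⟨n, rfl⟩ : ∃ n : ℕ, m = n + 1 := ⟨(m - 1).toNat, by lia⟩
    have h1 : (0 : ℤ) ≤ n + 1 := by lia
    have h2 : ((n : ℤ) + 1).toNat = n + 1 := by lia
    have h3 : p ^ ((n : ℤ) + 1) = p ^ (n + 1) := by exact_mod_cast zpow_natCast p (n + 1)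
    simp only [invEulerPoch, add_sub_cancel_right, Nat.cast_nonneg, if_true, h1, h2, h3,
      Int.toNat_natCast, eulerPoch, Finset.prod_range_succ]
    field_simp [one_sub_pow_ne_zero hp n]

/-- The coefficient of `x ^ k` in `∏_{j < n} (1 - p^j x) (1 - p^(j+1) / x)`, where `p = s ^ 2`.
The square root `s` of the nome turns the exponent `k (k - 1) / 2` of `p` into `k ^ 2 - k`. -/
noncomputable def tripleCoeff (s : ℂ) (n : ℕ) (k : ℤ) : ℂ :=
  (-1) ^ k * s ^ (k ^ 2 - k) *
    (eulerPoch (s ^ 2) (2 * n) * invEulerPoch (s ^ 2) (n + k) * invEulerPoch (s ^ 2) (n - k))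

lemma tripleCoeff_succ {s : ℂ} (hs0 : s ≠ 0) (hs : ‖s ^ 2‖ < 1) (n : ℕ) (k : ℤ) :
    tripleCoeff s (n + 1) k =
      (1 + (s ^ 2) ^ (2 * n + 1)) * tripleCoeff s n k - (s ^ 2) ^ n * tripleCoeff s n (k - 1)
        - (s ^ 2) ^ (n + 1) * tripleCoeff s n (k + 1) := by
  have hp0 : s ^ 2 ≠ 0 := pow_ne_zero _ hs0
  have e1 : invEulerPoch (s ^ 2) (n + k) =
      (1 - (s ^ 2) ^ (n + k + 1)) * invEulerPoch (s ^ 2) (n + k + 1) := by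
    rw [← invEulerPoch_sub_one hs]; congr 1; ring
  have e2 : invEulerPoch (s ^ 2) (n - k) =
      (1 - (s ^ 2) ^ (n - k + 1)) * invEulerPoch (s ^ 2) (n - k + 1) := by
    rw [← invEulerPoch_sub_one hs]; congr 1; ring
  have e3 : invEulerPoch (s ^ 2) (n + (k - 1)) =
      (1 - (s ^ 2) ^ (n + k)) * invEulerPoch (s ^ 2) (n + k) := by
    rw [← invEulerPoch_sub_one hs]; congr 1; ring
  have e4 : invEulerPoch (s ^ 2) (n - (k + 1)) =
      (1 - (s ^ 2) ^ (n - k)) * invEulerPoch (s ^ 2) (n - k) := by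
    rw [← invEulerPoch_sub_one hs]; congr 1; ring
  have e5 : ((n + 1 : ℕ) : ℤ) + k = n + k + 1 := by push_cast; ring
  have e6 : ((n + 1 : ℕ) : ℤ) - k = n - k + 1 := by push_cast; ring
  have e7 : (n : ℤ) - (k - 1) = n - k + 1 := by ring
  have e8 : (n : ℤ) + (k + 1) = n + k + 1 := by ring
  have e9 : eulerPoch (s ^ 2) (2 * (n + 1)) = eulerPoch (s ^ 2) (2 * n) *
      (1 - (s ^ 2) ^ (2 * n + 1)) * (1 - (s ^ 2) ^ (2 * n + 2)) := by
    rw [show 2 * (n + 1) = 2 * n + 1 + 1 by ring]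
    simp only [eulerPoch, Finset.prod_range_succ]
  have t1 : s ^ ((k - 1) ^ 2 - (k - 1)) = s ^ (k ^ 2 - k) * (s ^ 2) / (s ^ 2) ^ k := by
    rw [eq_div_iff (zpow_ne_zero _ hp0), ← zpow_natCast s 2, ← zpow_mul, ← zpow_add₀ hs0,
      ← zpow_add₀ hs0]
    congr 1; push_cast; ring
  have t2 : s ^ ((k + 1) ^ 2 - (k + 1)) = s ^ (k ^ 2 - k) * (s ^ 2) ^ k := by
    rw [← zpow_natCast s 2, ← zpow_mul, ← zpow_add₀ hs0]
    congr 1; push_cast; ring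
  have n1 : (-1 : ℂ) ^ (k - 1) = -(-1) ^ k := by rw [zpow_sub_one₀ (by norm_num)]; norm_num
  have n2 : (-1 : ℂ) ^ (k + 1) = -(-1) ^ k := by rw [zpow_add_one₀ (by norm_num)]; ring
  simp only [tripleCoeff, e5, e6, e7, e8, e9, e3, e4, e1, e2, t1, t2, n1, n2]
  simp only [zpow_add₀ hp0, zpow_sub₀ hp0, zpow_natCast, zpow_one]
  have hB : (s ^ 2) ^ k ≠ 0 := zpow_ne_zero _ hp0
  generalize (s ^ 2) ^ k = B at *
  generalize s ^ 2 = p at *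
  field_simp
  ring

/-- The finite form of the triple product identity. -/
lemma hasSum_tripleCoeff {s x : ℂ} (hs0 : s ≠ 0) (hs : ‖s ^ 2‖ < 1) (hx : x ≠ 0) (n : ℕ) :
    HasSum (fun k : ℤ => tripleCoeff s n k * x ^ k)
      (∏ j ∈ Finset.range n, ((1 - (s ^ 2) ^ j * x) * (1 - (s ^ 2) ^ (j + 1) / x))) := by
  induction n with
  | zero =>
    convert hasSum_single (0 : ℤ) (fun k hk => ?_) using 1
    · simp [tripleCoeff, eulerPoch, invEulerPoch]
    · rcases lt_or_gt_of_ne hk with h | h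
      · simp [tripleCoeff, invEulerPoch, not_le.mpr h]
      · simp [tripleCoeff, invEulerPoch, not_le.mpr h]
  | succ n ih =>
    rw [Finset.prod_range_succ]
    set F := ∏ j ∈ Finset.range n, ((1 - (s ^ 2) ^ j * x) * (1 - (s ^ 2) ^ (j + 1) / x))
    have h1 : HasSum (fun k : ℤ => tripleCoeff s n (k - 1) * x ^ (k - 1)) F :=
      ((Equiv.subRight (1 : ℤ)).hasSum_iff.mpr ih).congr_fun fun _ => rfl
    have h2 : HasSum (fun k : ℤ => tripleCoeff s n (k + 1) * x ^ (k + 1)) F :=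
      ((Equiv.addRight (1 : ℤ)).hasSum_iff.mpr ih).congr_fun fun _ => rfl
    have h3 := ((ih.mul_left (1 + (s ^ 2) ^ (2 * n + 1))).sub
      (h1.mul_left ((s ^ 2) ^ n * x))).sub (h2.mul_left ((s ^ 2) ^ (n + 1) / x))
    have e1 : F * ((1 - (s ^ 2) ^ n * x) * (1 - (s ^ 2) ^ (n + 1) / x)) =
        (1 + (s ^ 2) ^ (2 * n + 1)) * F - (s ^ 2) ^ n * x * F - (s ^ 2) ^ (n + 1) / x * F := by
      field_simp
      ring
    rw [e1]
    refine h3.congr_fun fun k => ?_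
    rw [tripleCoeff_succ hs0 hs, zpow_sub_one₀ hx, zpow_add_one₀ hx]
    generalize (s ^ 2) ^ (2 * n + 1) = u
    generalize (s ^ 2) ^ (n + 1) = v
    generalize (s ^ 2) ^ n = w
    field_simp

/-! ### The triple product identity -/

lemma summable_norm_pow_succ {p : ℂ} (hp : ‖p‖ < 1) : Summable fun j : ℕ => ‖-p ^ (j + 1)‖ := by
  simpa using (summable_nat_add_iff 1).mpr (summable_geometric_of_lt_one (norm_nonneg _) hp)

lemma exists_tendsto_eulerPoch {p : ℂ} (hp : ‖p‖ < 1) :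
    ∃ P : ℂ, P ≠ 0 ∧ Tendsto (eulerPoch p) atTop (𝓝 P) := by
  refine ⟨∏' j : ℕ, (1 + -p ^ (j + 1)), ?_, ?_⟩
  · refine tprod_one_add_ne_zero_of_summable (fun j => ?_) (summable_norm_pow_succ hp)
    simpa [← sub_eq_add_neg] using one_sub_pow_ne_zero hp j
  · simpa only [← sub_eq_add_neg] using!
      (multipliable_one_add_of_summable (summable_norm_pow_succ hp)).tendsto_prod_tprod_nat

lemma multipliable_modTheta {p : ℂ} (hp : ‖p‖ < 1) (x : ℂ) :
    Multipliable fun j : ℕ => (1 - p ^ j * x) * (1 - p ^ (j + 1) / x) := by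
  have h0 := (summable_geometric_of_lt_one (norm_nonneg _) hp)
  have h1 : Summable fun j : ℕ => ‖-(p ^ j * x)‖ := by
    simpa using h0.mul_right ‖x‖
  have h2 : Summable fun j : ℕ => ‖-(p ^ (j + 1) / x)‖ := by
    simpa using ((summable_nat_add_iff 1).mpr h0).div_const ‖x‖
  simpa only [sub_eq_add_neg] using
    (multipliable_one_add_of_summable h1).mul (multipliable_one_add_of_summable h2)

/-- The general term of the theta series `∑ (-1)^k s^(k^2 - k) x^k`. -/
noncomputable def thetaTerm (s x : ℂ) (k : ℤ) : ℂ := (-1) ^ k * s ^ (k ^ 2 - k) * x ^ k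

lemma summable_norm_thetaTerm {s : ℂ} (hs0 : s ≠ 0) (hs : ‖s‖ < 1) (x : ℂ) :
    Summable fun k => ‖thetaTerm s x k‖ := by
  refine (summable_zpow_sq_mul_zpow (y := x / s) hs).congr fun k => ?_
  rw [thetaTerm, zpow_sub₀ hs0, div_zpow]
  simp only [norm_mul, norm_div, norm_zpow, norm_neg, norm_one, one_zpow]
  ring

/-- Jacobi's triple product identity, with an unspecified normalising constant. It follows from
the finite form by dominated convergence. -/
theorem exists_modTheta_eq_tsum {s : ℂ} (hs0 : s ≠ 0) (hs : ‖s‖ < 1) :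
    ∃ C : ℂ, ∀ x : ℂ, x ≠ 0 → modTheta x (s ^ 2) = C * ∑' k : ℤ, thetaTerm s x k := by
  have hp : ‖s ^ 2‖ < 1 := by
    rw [norm_pow]; exact pow_lt_one₀ (norm_nonneg _) hs two_ne_zero
  obtain ⟨P, hP0, hP⟩ := exists_tendsto_eulerPoch hp
  have hPi : Tendsto (fun n => (eulerPoch (s ^ 2) n)⁻¹) atTop (𝓝 P⁻¹) := hP.inv₀ hP0
  obtain ⟨M, hM⟩ := hP.norm.bddAbove_range
  obtain ⟨N, hN⟩ := hPi.norm.bddAbove_range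
  have hM' : ∀ n, ‖eulerPoch (s ^ 2) n‖ ≤ M := fun n => hM ⟨n, rfl⟩
  have hN' : ∀ m, ‖invEulerPoch (s ^ 2) m‖ ≤ N := fun m => by
    rw [invEulerPoch]
    split_ifs
    · exact hN ⟨_, rfl⟩
    · rw [norm_zero]; exact (norm_nonneg _).trans (hN ⟨0, rfl⟩)
  have hM0 : 0 ≤ M := (norm_nonneg _).trans (hM' 0)
  have hN0 : 0 ≤ N := (norm_nonneg _).trans (hN' 0)
  have hlim : Tendsto (invEulerPoch (s ^ 2)) atTop (𝓝 P⁻¹) := by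
    have ht : Tendsto Int.toNat atTop atTop :=
      tendsto_atTop.mpr fun b => (eventually_ge_atTop (b : ℤ)).mono fun m hm => by lia
    refine (hPi.comp ht).congr' ?_
    filter_upwards [eventually_ge_atTop 0] with m hm
    simp [invEulerPoch, hm]
  refine ⟨P⁻¹, fun x hx => ?_⟩
  have hprod := (multipliable_modTheta hp x).tendsto_prod_tprod_nat
  refine tendsto_nhds_unique hprod ?_
  rw [← tsum_mul_left]
  simp_rw [← (hasSum_tripleCoeff hs0 hp hx _).tsum_eq]
  refine tendsto_tsum_of_dominated_convergence
    (bound := fun k => M * N * N * ‖thetaTerm s x k‖)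
    ((summable_norm_thetaTerm hs0 hs x).mul_left _) (fun k => ?_) (.of_forall fun n k => ?_)
  · have c1 : Tendsto (fun n : ℕ => eulerPoch (s ^ 2) (2 * n)) atTop (𝓝 P) :=
      hP.comp (tendsto_id.const_mul_atTop' two_pos)
    have c2 : Tendsto (fun n : ℕ => invEulerPoch (s ^ 2) (n + k)) atTop (𝓝 P⁻¹) :=
      hlim.comp (tendsto_atTop_add_const_right _ _ tendsto_natCast_atTop_atTop)
    have c3 : Tendsto (fun n : ℕ => invEulerPoch (s ^ 2) (n - k)) atTop (𝓝 P⁻¹) :=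
      hlim.comp (tendsto_atTop_add_const_right _ (-k) tendsto_natCast_atTop_atTop)
    have c4 := ((c1.mul c2).mul c3).mul_const (thetaTerm s x k)
    rw [mul_inv_cancel₀ hP0, one_mul] at c4
    refine c4.congr fun n => ?_
    rw [tripleCoeff, thetaTerm]
    ring
  · have : tripleCoeff s n k * x ^ k = eulerPoch (s ^ 2) (2 * n) * invEulerPoch (s ^ 2) (n + k) *
        invEulerPoch (s ^ 2) (n - k) * thetaTerm s x k := by
      rw [tripleCoeff, thetaTerm]; ring
    rw [this, norm_mul, norm_mul, norm_mul]
    gcongr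
    exacts [hM' _, hN' _, hN' _]

/-! ### Weierstrass' addition formula -/

/-- The even Gaussian series `∑ s^(N^2 / 2) x^N`, `N = 2 r`. -/
noncomputable def thetaEven (s x : ℂ) : ℂ := ∑' r : ℤ, s ^ (2 * r ^ 2) * x ^ (2 * r)

/-- The odd Gaussian series `∑ s^((N^2 - 1) / 2) x^N`, `N = 2 r + 1`; the shift in the exponent
makes it an integer. -/
noncomputable def thetaOdd (s x : ℂ) : ℂ := ∑' r : ℤ, s ^ (2 * r ^ 2 + 2 * r) * x ^ (2 * r + 1)

lemma norm_sq_lt_one {s : ℂ} (hs : ‖s‖ < 1) : ‖s ^ 2‖ < 1 := by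
  rw [norm_pow]; exact pow_lt_one₀ (norm_nonneg _) hs two_ne_zero

lemma summable_norm_thetaEven {s : ℂ} (hs : ‖s‖ < 1) (x : ℂ) :
    Summable fun r : ℤ => ‖s ^ (2 * r ^ 2) * x ^ (2 * r)‖ := by
  refine (summable_zpow_sq_mul_zpow (y := x ^ 2) (norm_sq_lt_one hs)).congr fun r => ?_
  rw [zpow_mul s, zpow_mul x]
  rfl

lemma summable_norm_thetaOdd {s x : ℂ} (hs0 : s ≠ 0) (hs : ‖s‖ < 1) (hx : x ≠ 0) :
    Summable fun r : ℤ => ‖s ^ (2 * r ^ 2 + 2 * r) * x ^ (2 * r + 1)‖ := by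
  refine ((summable_zpow_sq_mul_zpow (y := (s * x) ^ 2) (norm_sq_lt_one hs)).mul_right
    ‖x‖).congr fun r => ?_
  rw [zpow_add₀ hs0, zpow_add₀ hx, zpow_mul s, zpow_mul s, zpow_mul x, mul_pow, mul_zpow,
    zpow_one, ← norm_mul]
  congr 1
  simp only [zpow_ofNat]
  ring

lemma mul_thetaOdd {s x : ℂ} (hx : x ≠ 0) :
    x * thetaOdd s x = ∑' r : ℤ, s ^ (2 * r ^ 2 - 2 * r) * x ^ (2 * r) := by
  rw [thetaOdd, ← tsum_mul_left, ← (Equiv.subRight (1 : ℤ)).tsum_eq]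
  refine tsum_congr fun r => ?_
  simp only [Equiv.subRight_apply]
  rw [show 2 * (r - 1) ^ 2 + 2 * (r - 1) = 2 * r ^ 2 - 2 * r by ring,
    show 2 * r = 2 * (r - 1) + 1 + 1 by ring, zpow_add_one₀ hx (2 * (r - 1) + 1)]
  ring_nf

/-- Pairs of integers, split according to the parity of their sum and expressed through half-sum
and half-difference: `(m, n)` is `(r + t, r - t)` or `(r + t + 1, r - t)`. -/
def parityEquiv : (ℤ × ℤ) ⊕ (ℤ × ℤ) ≃ ℤ × ℤ where
  toFun := Sum.elim (fun u => (u.1 + u.2, u.1 - u.2)) (fun u => (u.1 + u.2 + 1, u.1 - u.2))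
  invFun v := if (v.1 + v.2) % 2 = 0 then .inl ((v.1 + v.2) / 2, (v.1 - v.2) / 2)
    else .inr ((v.1 + v.2) / 2, (v.1 - v.2) / 2)
  left_inv u := by
    rcases u with ⟨r, t⟩ | ⟨r, t⟩
    · have h : (r + t + (r - t)) % 2 = 0 := by lia
      simp only [Sum.elim_inl, h, if_true, Sum.inl.injEq, Prod.mk.injEq]
      constructor <;> lia
    · have h : ¬ (r + t + 1 + (r - t)) % 2 = 0 := by lia
      simp only [Sum.elim_inr, h, if_false, Sum.inr.injEq, Prod.mk.injEq]
      constructor <;> lia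
  right_inv v := by
    obtain ⟨m, n⟩ := v
    dsimp only
    split_ifs with h
    · simp only [Sum.elim_inl, Prod.mk.injEq]
      constructor <;> lia
    · simp only [Sum.elim_inr, Prod.mk.injEq]
      constructor <;> lia

lemma hasSum_prod_mul {f g : ℤ → ℂ} (hf : Summable fun k => ‖f k‖) (hg : Summable fun k => ‖g k‖) :
    HasSum (fun u : ℤ × ℤ => f u.1 * g u.2) ((∑' k, f k) * ∑' k, g k) := by
  rw [tsum_mul_tsum_of_summable_norm hf hg]
  exact (summable_mul_of_summable_norm hf hg).hasSum

/-- The product of theta functions at `x y` and `x / y` is a `2 × 2` determinant in functions of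
`x` alone and of `y` alone. -/
theorem tsum_thetaTerm_mul {s x y : ℂ} (hs0 : s ≠ 0) (hs : ‖s‖ < 1) (hx : x ≠ 0) (hy : y ≠ 0) :
    (∑' k, thetaTerm s (x * y) k) * (∑' k, thetaTerm s (x / y) k) =
      x * (thetaOdd s x * thetaEven s y - thetaEven s x * thetaOdd s y) := by
  have hJ := hasSum_prod_mul (summable_norm_thetaTerm hs0 hs (x * y))
    (summable_norm_thetaTerm hs0 hs (x / y))
  have hxO : Summable fun r : ℤ => ‖s ^ (2 * r ^ 2 - 2 * r) * x ^ (2 * r)‖ := by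
    refine (summable_zpow_sq_mul_zpow (y := (x / s) ^ 2) (norm_sq_lt_one hs)).congr fun r => ?_
    rw [zpow_sub₀ hs0, zpow_mul s, zpow_mul s, zpow_mul x, div_pow, div_zpow]
    congr 1
    simp only [zpow_ofNat]
    ring
  have h1 := hasSum_prod_mul hxO (summable_norm_thetaEven hs y)
  have h2 := (hasSum_prod_mul (summable_norm_thetaEven hs x)
    (summable_norm_thetaOdd hs0 hs hy)).mul_left (-x)
  have h3 := HasSum.sum (f := (fun u : ℤ × ℤ => thetaTerm s (x * y) u.1 * thetaTerm s (x / y) u.2)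
    ∘ parityEquiv) (h1.congr_fun fun u => ?_) (h2.congr_fun fun u => ?_)
  · have h4 := (parityEquiv.hasSum_iff.mp h3).unique hJ
    rw [← h4, ← mul_thetaOdd hx, ← thetaEven, ← thetaEven, ← thetaOdd]
    ring
  · obtain ⟨r, t⟩ := u
    simp only [Function.comp_apply, parityEquiv, Equiv.coe_fn_mk, Sum.elim_inl, thetaTerm]
    have e1 : (-1 : ℂ) ^ (r + t) * (-1) ^ (r - t) = 1 := by
      rw [← zpow_add₀ (by norm_num), show r + t + (r - t) = 2 * r by ring, zpow_mul]; simp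
    have e2 : s ^ ((r + t) ^ 2 - (r + t)) * s ^ ((r - t) ^ 2 - (r - t)) =
        s ^ (2 * r ^ 2 - 2 * r) * s ^ (2 * t ^ 2) := by
      rw [← zpow_add₀ hs0, ← zpow_add₀ hs0]; congr 1; ring
    have e3 : (x * y) ^ (r + t) * (x / y) ^ (r - t) = x ^ (2 * r) * y ^ (2 * t) := by
      rw [mul_zpow, div_zpow, div_eq_mul_inv, ← zpow_neg, mul_mul_mul_comm, ← zpow_add₀ hx,
        ← zpow_add₀ hy]
      congr 2 <;> ring
    linear_combination (s ^ ((r + t) ^ 2 - (r + t)) * s ^ ((r - t) ^ 2 - (r - t)) *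
      ((x * y) ^ (r + t) * (x / y) ^ (r - t))) * e1 +
      ((x * y) ^ (r + t) * (x / y) ^ (r - t)) * e2 +
      s ^ (2 * r ^ 2 - 2 * r) * s ^ (2 * t ^ 2) * e3
  · obtain ⟨r, t⟩ := u
    simp only [Function.comp_apply, parityEquiv, Equiv.coe_fn_mk, Sum.elim_inr, thetaTerm]
    have e1 : (-1 : ℂ) ^ (r + t + 1) * (-1) ^ (r - t) = -1 := by
      rw [← zpow_add₀ (by norm_num), show r + t + 1 + (r - t) = 2 * r + 1 by ring,
        zpow_add₀ (by norm_num), zpow_mul]; simp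
    have e2 : s ^ ((r + t + 1) ^ 2 - (r + t + 1)) * s ^ ((r - t) ^ 2 - (r - t)) =
        s ^ (2 * r ^ 2) * s ^ (2 * t ^ 2 + 2 * t) := by
      rw [← zpow_add₀ hs0, ← zpow_add₀ hs0]; congr 1; ring
    have e3 : (x * y) ^ (r + t + 1) * (x / y) ^ (r - t) = x * x ^ (2 * r) * y ^ (2 * t + 1) := by
      rw [mul_zpow, div_zpow, div_eq_mul_inv, ← zpow_neg, mul_mul_mul_comm, ← zpow_add₀ hx,
        ← zpow_add₀ hy, ← zpow_one_add₀ hx]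
      congr 2 <;> ring
    linear_combination (s ^ ((r + t + 1) ^ 2 - (r + t + 1)) * s ^ ((r - t) ^ 2 - (r - t)) *
      ((x * y) ^ (r + t + 1) * (x / y) ^ (r - t))) * e1 -
      ((x * y) ^ (r + t + 1) * (x / y) ^ (r - t)) * e2 -
      s ^ (2 * r ^ 2) * s ^ (2 * t ^ 2 + 2 * t) * e3

lemma modTheta_zero_right (x : ℂ) : modTheta x 0 = 1 - x := by
  rw [modTheta, tprod_eq_mulSingle 0 fun j hj => by simp [hj]]
  simp

lemma modTheta_one_left (p : ℂ) : modTheta 1 p = 0 :=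
  tprod_of_exists_eq_zero ⟨0, by simp⟩

/-- Weierstrass' addition formula for theta functions. For `p ≠ 0` it is the Plücker relation
between the `2 × 2` minors of the matrix with columns `(thetaOdd, thetaEven)` at four points. -/
theorem modTheta_addition {p a b x y : ℂ} (hp : ‖p‖ < 1) (ha : a ≠ 0) (hb : b ≠ 0) (hx : x ≠ 0)
    (hy : y ≠ 0) :
    modTheta x p * modTheta (a * x) p * (modTheta (b * y) p * modTheta (a * y / b) p) -
      modTheta y p * modTheta (a * y) p * (modTheta (b * x) p * modTheta (a * x / b) p) =
    y * (modTheta (x / y) p * modTheta (a * x * y) p * (modTheta b p * modTheta (a / b) p)) := by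
  by_cases hp0 : p = 0
  · subst hp0
    simp only [modTheta_zero_right]
    field_simp
    ring
  obtain ⟨s, rfl⟩ : ∃ s : ℂ, p = s ^ 2 := (IsAlgClosed.exists_pow_nat_eq p two_pos).imp
    fun _ h => h.symm
  obtain ⟨w, rfl⟩ : ∃ w : ℂ, a = w ^ 2 := (IsAlgClosed.exists_pow_nat_eq a two_pos).imp
    fun _ h => h.symm
  have hs0 : s ≠ 0 := by rintro rfl; simp at hp0
  have hw : w ≠ 0 := by rintro rfl; simp at ha
  have hs : ‖s‖ < 1 := by
    rw [norm_pow] at hp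
    exact (pow_lt_one_iff_of_nonneg (norm_nonneg _) two_ne_zero).mp hp
  obtain ⟨C, hC⟩ := exists_modTheta_eq_tsum hs0 hs
  have key : ∀ {u v : ℂ}, u ≠ 0 → v ≠ 0 → modTheta (u / v) (s ^ 2) * modTheta (u * v) (s ^ 2) =
      C ^ 2 * u * (thetaOdd s u * thetaEven s v - thetaEven s u * thetaOdd s v) := by
    intro u v hu hv
    rw [hC _ (div_ne_zero hu hv), hC _ (mul_ne_zero hu hv)]
    linear_combination C ^ 2 * tsum_thetaTerm_mul hs0 hs hu hv
  have hwx := mul_ne_zero hw hx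
  have hwy := mul_ne_zero hw hy
  have hbw := div_ne_zero hb hw
  have k1 := key hwx hw
  have k2 := key hwy hbw
  have k3 := key hwy hw
  have k4 := key hwx hbw
  have k5 := key hwx hwy
  have k6 := key hw hbw
  rw [show w * x / w = x by field_simp, show w * x * w = w ^ 2 * x by ring] at k1
  rw [show w * y / (b / w) = w ^ 2 * y / b by field_simp, show w * y * (b / w) = b * y by
    field_simp, mul_comm (modTheta _ _)] at k2
  rw [show w * y / w = y by field_simp, show w * y * w = w ^ 2 * y by ring] at k3
  rw [show w * x / (b / w) = w ^ 2 * x / b by field_simp, show w * x * (b / w) = b * x by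
    field_simp, mul_comm (modTheta _ _)] at k4
  rw [show w * x / (w * y) = x / y by field_simp,
    show w * x * (w * y) = w ^ 2 * x * y by ring] at k5
  rw [show w / (b / w) = w ^ 2 / b by field_simp, show w * (b / w) = b by field_simp,
    mul_comm (modTheta _ _)] at k6
  rw [k1, k2, k3, k4, k5, k6]
  ring

/-! ### Differences of elliptic numbers -/

lemma ellipticNumber_zero (a b q p : ℂ) : ellipticNumber a b q p 0 = 0 := by
  simp [ellipticNumber, modTheta_one_left]

/-- The difference of two elliptic numbers is a weight times an elliptic number with shifted
parameters: after cancellation this is Weierstrass' addition formula at `q ^ l` and `q ^ i`. -/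
theorem ellipticNumber_sub {a b q p : ℂ} (ha : a ≠ 0) (hb : b ≠ 0) (hq : q ≠ 0) (hp : ‖p‖ < 1)
    (hdef : ∀ i : ℕ, EllipticNumberDefined a b q p (i : ℂ)) (i l : ℕ)
    (hil : EllipticNumberDefined (a * q ^ (2 * i)) (b * q ^ i) q p ((l : ℂ) - (i : ℂ))) :
    ellipticWeight a b q p (i : ℂ) *
        ellipticNumber (a * q ^ (2 * i)) (b * q ^ i) q p ((l : ℂ) - (i : ℂ)) =
      ellipticNumber a b q p (l : ℂ) - ellipticNumber a b q p (i : ℂ) := by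
  obtain ⟨-, d0, -, -⟩ := hil
  obtain ⟨d1, d2, d3, d4⟩ := hdef i
  obtain ⟨-, -, d5, d6⟩ := hdef l
  obtain ⟨-, -, d7, d8⟩ := hdef (i + 1)
  have key := modTheta_addition hp ha hb (pow_ne_zero l hq) (pow_ne_zero i hq)
  have c1 : q ^ (2 * (i : ℂ) + 1) = q ^ (2 * i) * q := by
    rw [← pow_succ, ← Complex.cpow_natCast]; push_cast; rfl
  have c2 : q ^ ((i : ℂ) + 1) = q ^ i * q := by
    rw [← pow_succ, ← Complex.cpow_natCast]; push_cast; rfl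
  have c3 : q ^ ((l : ℂ) - (i : ℂ)) = q ^ l / q ^ i := by
    rw [Complex.cpow_sub _ _ hq, Complex.cpow_natCast, Complex.cpow_natCast]
  have c4 : q ^ (2 * i) = q ^ i * q ^ i := by rw [two_mul, pow_add]
  rw [Nat.cast_add_one, c2] at d7 d8
  rw [Complex.cpow_natCast] at d3 d4 d5 d6
  simp only [ellipticWeight, ellipticNumber, c1, c2, c3, Complex.cpow_natCast]
  rw [c4] at d0 ⊢
  have hY : q ^ i ≠ 0 := pow_ne_zero i hq
  generalize q ^ i = Y at *
  generalize q ^ l = X at *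
  rw [show a * (Y * Y) * (X / Y) = a * X * Y by field_simp,
    show b * Y * (X / Y) = b * X by field_simp,
    show a * X * Y / (b * Y) = a * X / b by field_simp,
    show b * Y * q = b * (Y * q) by ring,
    show a * (Y * Y) * q / (b * Y) = a * (Y * q) / b by field_simp,
    show a * (Y * Y * q) = a * (Y * Y) * q by ring]
  generalize modTheta (a * (Y * Y) * q) p = t0 at *
  generalize modTheta (b * (Y * q)) p = t1 at *
  generalize modTheta (a * (Y * q) / b) p = t2 at *
  generalize modTheta (b * Y) p = t3 at *
  generalize modTheta (a * Y / b) p = t4 at *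
  generalize modTheta (b * X) p = t5 at *
  generalize modTheta (a * X / b) p = t6 at *
  generalize modTheta q p = t7 at *
  generalize modTheta (a * q) p = t8 at *
  generalize modTheta (X / Y) p = t9 at *
  generalize modTheta (a * X * Y) p = t10 at *
  generalize modTheta X p = t11 at *
  generalize modTheta (a * X) p = t12 at *
  generalize modTheta Y p = t13 at *
  generalize modTheta (a * Y) p = t14 at *
  generalize modTheta (b * q) p = t15 at *
  generalize modTheta (a * q / b) p = t16 at *
  generalize modTheta b p = t17 at *
  generalize modTheta (a / b) p = t18 at *
  have e1 : t0 * t17 * t15 * t18 * t16 / (t8 * t3 * t1 * t4 * t2) * Y *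
      (t9 * t10 * t1 * t2 / (t7 * t0 * t5 * t6)) =
      t15 * t16 * (Y * (t9 * t10 * (t17 * t18))) / (t7 * t8 * t3 * t4 * t5 * t6) := by
    field_simp
  rw [e1, ← key]
  field_simp

/-! ### Newton interpolation -/

/-- The Newton basis polynomial `(X - c 0) ⋯ (X - c (m - 1))`. -/
noncomputable def newtonPoly {F : Type*} [Field F] (c : ℕ → F) (m : ℕ) : Polynomial F :=
  ∏ i ∈ Finset.range m, (Polynomial.X - Polynomial.C (c i))

lemma monic_newtonPoly {F : Type*} [Field F] (c : ℕ → F) (m : ℕ) : (newtonPoly c m).Monic :=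
  Polynomial.monic_prod_of_monic _ _ fun i _ => Polynomial.monic_X_sub_C (c i)

lemma natDegree_newtonPoly {F : Type*} [Field F] (c : ℕ → F) (m : ℕ) :
    (newtonPoly c m).natDegree = m := by
  rw [newtonPoly, Polynomial.natDegree_prod_of_monic _ _ fun i _ => Polynomial.monic_X_sub_C (c i)]
  simp

lemma eval_newtonPoly {F : Type*} [Field F] (c : ℕ → F) (m : ℕ) (x : F) :
    (newtonPoly c m).eval x = ∏ i ∈ Finset.range m, (x - c i) := by
  simp [newtonPoly, Polynomial.eval_prod]

/-- The divided difference at `c 0, …, c k` of the Newton basis polynomial of index `m` is `1` for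
`m = k` and `0` otherwise: for `m ≤ k` it is a coefficient of that polynomial, and for `m > k` the
polynomial vanishes at all nodes. -/
lemma sum_newton_div {F : Type*} [Field F] (c : ℕ → F) (k m : ℕ)
    (hc : Set.InjOn c (Finset.range (k + 1))) :
    ∑ l ∈ Finset.range (k + 1),
      (∏ i ∈ Finset.range m, (c l - c i)) / ∏ i ∈ (Finset.range (k + 1)).erase l, (c l - c i) =
      if m = k then 1 else 0 := by
  rcases le_or_gt m k with h | h
  · have hdeg : (newtonPoly c m).degree < (Finset.range (k + 1)).card := by
      rw [Polynomial.degree_eq_natDegree (monic_newtonPoly c m).ne_zero, natDegree_newtonPoly,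
        Finset.card_range]
      exact_mod_cast Nat.lt_succ_of_le h
    have := Lagrange.coeff_eq_sum hc hdeg
    simp only [eval_newtonPoly, Finset.card_range, Nat.add_sub_cancel] at this
    rw [← this]
    split_ifs with hk
    · subst hk
      have := monic_newtonPoly c m
      rwa [Polynomial.Monic, Polynomial.leadingCoeff, natDegree_newtonPoly] at this
    · exact Polynomial.coeff_eq_zero_of_natDegree_lt (by rw [natDegree_newtonPoly]; lia)
  · rw [if_neg h.ne']
    refine Finset.sum_eq_zero fun l hl => ?_
    have hl' : l ∈ Finset.range m := by simp only [Finset.mem_range] at hl ⊢; lia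
    rw [Finset.prod_eq_zero hl' (sub_self _), zero_div]

lemma ellipticFalling_eq_prod (a b q p x : ℂ) (m : ℕ) :
    ellipticFalling a b q p x m = ∏ i ∈ Finset.range m, (x - ellipticNumber a b q p (i : ℂ)) := by
  cases m with
  | zero => rfl
  | succ m =>
    rw [ellipticFalling, Finset.prod_range_succ', Nat.cast_zero, ellipticNumber_zero, sub_zero,
      mul_comm, show Finset.Icc 1 m = Finset.Ico 1 (m + 1) from rfl, Finset.prod_Ico_eq_prod_range]
    congr 1
    refine Finset.prod_congr (by simp) fun i _ => ?_
    rw [add_comm]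

/-- The coefficients of `x ^ n` in the Newton basis at the nodes `c`. -/
def newtonCoeff {R : Type*} [CommRing R] (c : ℕ → R) : ℕ → ℕ → R
  | 0, 0 => 1
  | 0, _ + 1 => 0
  | n + 1, 0 => c 0 * newtonCoeff c n 0
  | n + 1, k + 1 => newtonCoeff c n k + c (k + 1) * newtonCoeff c n (k + 1)

lemma newtonCoeff_eq_zero {R : Type*} [CommRing R] (c : ℕ → R) (n : ℕ) :
    ∀ k, n < k → newtonCoeff c n k = 0 := by
  induction n with
  | zero => rintro (_ | k) h <;> simp_all [newtonCoeff]
  | succ n ih =>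
    rintro (_ | k) h
    · simp at h
    · rw [newtonCoeff, ih k (by lia), ih (k + 1) (by lia), mul_zero, add_zero]

lemma pow_eq_sum_newtonCoeff {R : Type*} [CommRing R] (c : ℕ → R) (x : R) (n : ℕ) :
    x ^ n = ∑ k ∈ Finset.range (n + 1),
      newtonCoeff c n k * ∏ i ∈ Finset.range k, (x - c i) := by
  induction n with
  | zero => simp [newtonCoeff]
  | succ n ih =>
    have h : ∑ k ∈ Finset.range (n + 1), newtonCoeff c n k * ∏ i ∈ Finset.range k, (x - c i) =
        ∑ k ∈ Finset.range (n + 2), newtonCoeff c n k * ∏ i ∈ Finset.range k, (x - c i) := by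
      rw [Finset.sum_range_succ _ (n + 1), newtonCoeff_eq_zero c n (n + 1) (by lia), zero_mul,
        add_zero]
    have h2 : ∑ k ∈ Finset.range (n + 2),
          c k * (newtonCoeff c n k * ∏ i ∈ Finset.range k, (x - c i)) =
        ∑ k ∈ Finset.range (n + 1),
          c k * (newtonCoeff c n k * ∏ i ∈ Finset.range k, (x - c i)) := by
      rw [Finset.sum_range_succ _ (n + 1), newtonCoeff_eq_zero c n (n + 1) (by lia), zero_mul,
        mul_zero, add_zero]
    rw [Finset.sum_range_succ'] at h2 ⊢
    simp only [newtonCoeff, add_mul, Finset.sum_add_distrib]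
    rw [add_assoc]
    have h3 : ∑ k ∈ Finset.range (n + 1),
          c (k + 1) * newtonCoeff c n (k + 1) * ∏ i ∈ Finset.range (k + 1), (x - c i) +
        c 0 * newtonCoeff c n 0 * ∏ i ∈ Finset.range 0, (x - c i) =
        ∑ k ∈ Finset.range (n + 1),
          c k * (newtonCoeff c n k * ∏ i ∈ Finset.range k, (x - c i)) := by
      rw [← h2]
      simp only [mul_assoc]
    rw [h3, ← Finset.sum_add_distrib, pow_succ, ih, Finset.sum_mul]
    refine Finset.sum_congr rfl fun k _ => ?_
    rw [Finset.prod_range_succ]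
    ring

theorem mainTheorem3 (a b q p : ℂ) (ha : a ≠ 0) (hb : b ≠ 0) (hq : q ≠ 0) (hp : ‖p‖ < 1)
    (hdef : ∀ i : ℕ, EllipticNumberDefined a b q p (i : ℂ)) :
    (∃ S : ℕ → ℕ → ℂ, IsEllipticStirling a b q p S) ∧
    ∀ S : ℕ → ℕ → ℂ, IsEllipticStirling a b q p S →
      ∀ n k : ℕ,
        (∀ i l : ℕ, i ≤ k → l ≤ k → i ≠ l →
          EllipticNumberDefined (a * q ^ (2 * i)) (b * q ^ i) q p ((l : ℂ) - (i : ℂ)) ∧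
          ellipticWeight a b q p (i : ℂ) *
            ellipticNumber (a * q ^ (2 * i)) (b * q ^ i) q p ((l : ℂ) - (i : ℂ)) ≠ 0) →
        S n k =
          ∑ j ∈ Finset.range (k + 1),
            (∏ i ∈ (Finset.range (k + 1)).erase (k - j),
              (ellipticWeight a b q p (i : ℂ) *
                ellipticNumber (a * q ^ (2 * i)) (b * q ^ i) q p
                  ((k : ℂ) - (j : ℂ) - (i : ℂ)))⁻¹) *
              ellipticNumber a b q p ((k : ℂ) - (j : ℂ)) ^ n := by
  set c : ℕ → ℂ := fun i => ellipticNumber a b q p (i : ℂ) with hcdef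
  refine ⟨⟨newtonCoeff c, newtonCoeff_eq_zero c, fun n z _ => ?_⟩, fun S hS n k hk => ?_⟩
  · simp_rw [ellipticFalling_eq_prod]
    exact pow_eq_sum_newtonCoeff c _ n
  have hdiff : ∀ i l : ℕ, i ≤ k → l ≤ k → i ≠ l →
      ellipticWeight a b q p (i : ℂ) *
        ellipticNumber (a * q ^ (2 * i)) (b * q ^ i) q p ((l : ℂ) - (i : ℂ)) = c l - c i :=
    fun i l hi hl hil => ellipticNumber_sub ha hb hq hp hdef i l (hk i l hi hl hil).1
  have hinj : Set.InjOn c (Finset.range (k + 1)) := by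
    intro i hi l hl h
    by_contra hil
    simp only [Finset.coe_range, Set.mem_Iio, Nat.lt_succ_iff] at hi hl
    exact (hk i l hi hl hil).2 (by rw [hdiff i l hi hl hil, h, sub_self])
  -- Reversing the order of summation turns the right-hand side into the divided difference of
  -- `x ^ n` at the nodes `c 0, …, c k`.
  rw [← Finset.sum_range_reflect]
  have hrhs : ∀ l ∈ Finset.range (k + 1),
      (∏ i ∈ (Finset.range (k + 1)).erase (k - (k + 1 - 1 - l)),
        (ellipticWeight a b q p (i : ℂ) * ellipticNumber (a * q ^ (2 * i)) (b * q ^ i) q p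
          ((k : ℂ) - ((k + 1 - 1 - l : ℕ) : ℂ) - (i : ℂ)))⁻¹) *
        ellipticNumber a b q p ((k : ℂ) - ((k + 1 - 1 - l : ℕ) : ℂ)) ^ n =
      ∑ m ∈ Finset.range (n + 1), S n m * ((∏ i ∈ Finset.range m, (c l - c i)) /
        ∏ i ∈ (Finset.range (k + 1)).erase l, (c l - c i)) := by
    intro l hl
    have hl' : l ≤ k := Nat.lt_succ_iff.mp (Finset.mem_range.mp hl)
    have e1 : k - (k + 1 - 1 - l) = l := by lia
    have e2 : (k : ℂ) - ((k + 1 - 1 - l : ℕ) : ℂ) = l := by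
      rw [Nat.add_sub_cancel, Nat.cast_sub hl']; ring
    have e3 : ∏ i ∈ (Finset.range (k + 1)).erase l, (ellipticWeight a b q p (i : ℂ) *
          ellipticNumber (a * q ^ (2 * i)) (b * q ^ i) q p ((l : ℂ) - (i : ℂ)))⁻¹ =
        (∏ i ∈ (Finset.range (k + 1)).erase l, (c l - c i))⁻¹ := by
      rw [← Finset.prod_inv_distrib]
      refine Finset.prod_congr rfl fun i hi => ?_
      obtain ⟨hi1, hi2⟩ := Finset.mem_erase.mp hi
      rw [hdiff i l (Nat.lt_succ_iff.mp (Finset.mem_range.mp hi2)) hl' hi1]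
    rw [e1, e2, e3, hS.2 n l (hdef l), Finset.mul_sum]
    refine Finset.sum_congr rfl fun m _ => ?_
    rw [ellipticFalling_eq_prod]
    ring
  rw [Finset.sum_congr rfl hrhs, Finset.sum_comm]
  simp_rw [← Finset.mul_sum, sum_newton_div c k _ hinj]
  by_cases hkn : k ≤ n
  · simp [Nat.lt_succ_of_le hkn]
  · rw [hS.1 n k (not_le.mp hkn)]
    simp [hkn]
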